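/- **Theorem (bicrossed product of a matched pair of $L_\infty$-algebras).** Everything is over a field $\mathbf k$ of characteristic zero. *Conventions.* $\varepsilon(\sigma)$ is the Koszul sign of a permutation $\sigma$ of homogeneous letters, $(-1)^\sigma$ its signature, and $\mathrm{Sh}(p,q)\subset\mathbb S_{p+q}$ the set of $(p,q)$-shuffles. An *$L_\infty$-algebra* is a graded space $\mathcal G=\bigoplus_{i\in\mathbb Z}\mathcal G^i$ with graded skew-symmetric linear maps $\mu_k:\mathcal G^{\otimes k}\to\mathcal G$ of degree $k-2$ $(k\ge1)$ such that for all $N\ge 1$ and homogeneous $x_1,\dots,x_N$ $$\sum_{k+l=N+1}\ \sum_{\sigma\in \mathrm{Sh}(l,k-1)}(-1)^\sigma\varepsilon(\sigma)(-1)^{l(k-1)}\mu_k\big(\mu_l(x_{\sigma(1)},\dots,x_{\sigma(l)}),x_{\sigma(l+1)},\dots,x_{\sigma(N)}\big)=0 .$$ A *representation* of it on a graded space $\mathcal H$ is a family of linear maps $\rho_k:\mathcal G^{\otimes k-1}\otimes\mathcal H\to\mathcal H$ of degree $k-2$ $(k\ge 1)$, graded skew-symmetric in the inputs from $\mathcal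 G$, such that for all $N\ge1$ and homogeneous $x_1,\dots,x_{N-1}\in\mathcal G$, $x_N\in\mathcal H$ $$\sum_{k+l=N+1}\ \sum_{\substack{\sigma\in \mathrm{Sh}(l,k-1)\\ \sigma(l)=N}}(-1)^\sigma\varepsilon(\sigma)(-1)^{(l-1)(k-1)+(|x_{\sigma(1)}|+\cdots+|x_{\sigma(l)}|+l)(|x_{\sigma(l+1)}|+\cdots+|x_{\sigma(N)}|)}\rho_k\big(x_{\sigma(l+1)},\dots,x_{\sigma(N)},\rho_l(x_{\sigma(1)},\dots,x_{\sigma(l)})\big)$$ $$+\sum_{\substack{k+l=N+1\\ k\ge2}}\ \sum_{\substack{\sigma\in \mathrm{Sh}(l,k-1)\\ \sigma(N)=N}}(-1)^\sigma\varepsilon(\sigma)(-1)^{l(k-1)}\rho_k\big(\mu_l(x_{\sigma(1)},\dots,x_{\sigma(l)}),x_{\sigma(l+1)},\dots,x_{\sigma(N)}\big)=0 .$$ A *matched pair of $L_\infty$-algebras* consists of $L_\infty$-algebras $(\mathcal G,\{\mu_k\})$ and $(\mathcal H,\{\nu_k\})$, a representation $\{\rho_k\}$ of $\mathcal G$ on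 $\mathcal H$ and a representation $\{\psi_k\}$ of $\mathcal H$ on $\mathcal G$ such that the following compatibility condition, and the one obtained from it by interchanging $(\mathcal G,\mu,\rho,x)$ and $(\mathcal H,\nu,\psi,h)$, hold for all $N\ge1$ and all homogeneous $(x_1,h_1),\dots,(x_N,h_N)\in\mathcal G\oplus\mathcal H$, of degrees $d_1,\dots,d_N$: $$\sum_{k+l=N+1}\ \sum_{\sigma\in\mathrm{Sh}(l,k-1)}(-1)^\sigma\varepsilon(\sigma)(-1)^{l(k-1)}\,T_{k,l,\sigma}=0,$$ where, writing $y_i=x_{\sigma(i)}$, $g_i=h_{\sigma(i)}$, $e_i=d_{\sigma(i)}$ for $1\le i\le N$, $$\alpha_i=(-1)^{l-i+e_i(e_{i+1}+\cdots+e_l)}\ (1\le i\le l),\qquad \beta_j=(-1)^{k-1-j+e_{l+j}(e_{l+j+1}+\cdots+e_N)}\ (1\le j\le k-1),$$ $$\gamma=(-1)^{k-1+(e_1+\cdots+e_l+l-2)(e_{l+1}+\cdots+e_N)},$$ $T_{k,l,\sigma}$ is the sum $$\begin{aligned}T_{k,l,\sigma}={}&\mu_k\big(\mu_l(y_1,\dots,y_l),y_{l+1},\dots,y_N\big)+\sum_{i=1}^l\alpha_i\,\mu_k\big(\psi_l(g_1,\dots,\widehat{g_i},\dots,g_l,y_i),y_{l+1},\dots,y_N\big)\\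 &+\sum_{j=1}^{k-1}\beta_j\,\psi_k\big(\nu_l(g_1,\dots,g_l),g_{l+1},\dots,\widehat{g_{l+j}},\dots,g_N,y_{l+j}\big)\\ &+\sum_{j=1}^{k-1}\sum_{i=1}^{l}\alpha_i\beta_j\,\psi_k\big(\rho_l(y_1,\dots,\widehat{y_i},\dots,y_l,g_i),g_{l+1},\dots,\widehat{g_{l+j}},\dots,g_N,y_{l+j}\big)\\ &+\gamma\,\psi_k\big(g_{l+1},\dots,g_N,\mu_l(y_1,\dots,y_l)\big)+\sum_{i=1}^l\alpha_i\gamma\,\psi_k\big(g_{l+1},\dots,g_N,\psi_l(g_1,\dots,\widehat{g_i},\dots,g_l,y_i)\big).\end{aligned}$$ *Statement.* (1) Let $\big((\mathcal G,\{\mu_k\}),(\mathcal H,\{\nu_k\}),\{\rho_k\},\{\psi_k\}\big)$ be a matched pair of $L_\infty$-algebras. Then there is a unique family of linear maps $l_k:(\mathcal G\oplus\mathcal H)^{\otimes k}\to\mathcal G\oplus\mathcal H$ $(k\ge1)$ that is given on homogeneous elements by $l_k=\mu_k\ltimes\rho_k+\psi_k\rtimes\nu_k$, that is, $$\begin{aligned}l_k\big((x_1,h_1),\dots,(x_k,h_k)\big)=\Big(&\mu_k(x_1,\dots,x_k)+\sum_{i=1}^k(-1)^{k-i}(-1)^{|x_i|(|h_{i+1}|+\cdots+|h_k|)}\psi_k(h_1,\dots,\widehat{h_i},\dots,h_k,x_i),\\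 &\nu_k(h_1,\dots,h_k)+\sum_{i=1}^k(-1)^{k-i}(-1)^{|h_i|(|x_{i+1}|+\cdots+|x_k|)}\rho_k(x_1,\dots,\widehat{x_i},\dots,x_k,h_i)\Big),\end{aligned}$$ and $(\mathcal G\oplus\mathcal H,\{l_k\}_{k\ge1})$ is an $L_\infty$-algebra. (2) This generalizes the bicrossed product of Lie algebras: let $\mathfrak g,\mathfrak h$ be Lie algebras with representations $\rho$ of $\mathfrak g$ on $\mathfrak h$ and $\psi$ of $\mathfrak h$ on $\mathfrak g$ forming a matched pair of Lie algebras, i.e. $\rho_x[h,k]=[\rho_xh,k]+[h,\rho_xk]+\rho_{\psi_kx}h-\rho_{\psi_hx}k$ and $\psi_h[x,y]=[\psi_hx,y]+[x,\psi_hy]+\psi_{\rho_yh}x-\psi_{\rho_xh}y$. Placed in degree $0$, with $\mu_2,\nu_2$ the brackets, $\rho_2=\rho$, $\psi_2=\psi$ and all other maps zero, they form a matched pair of $L_\infty$-algebras, for which $l_k=0$ for $k\ne2$ and $$l_2\big((x,h),(y,k)\big)=\big([x,y]+\psi_hy-\psi_kx,\ [h,k]+\rho_xk-\rho_yh\big).$$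 -/

import Mathlib

open Finset

namespace LInf

section Signs

/-- The Koszul sign `ε(σ)` of a permutation `σ` of homogeneous letters of degrees `d`:
`x₁ ⊙ ⋯ ⊙ x_N = ε(σ) x_{σ(1)} ⊙ ⋯ ⊙ x_{σ(N)}` in the graded symmetric algebra. -/
def koszul {N : ℕ} (d : Fin N → ℤ) (σ : Equiv.Perm (Fin N)) : ℤˣ :=
  ∏ p : Fin N, ∏ q : Fin N with p < q ∧ σ q < σ p, (d (σ p) * d (σ q)).negOnePow

/-- The `(p, q)`-shuffles: permutations of `p + q` letters that are increasing on the first `p`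
and on the last `q` positions. -/
def shuffles (p q : ℕ) : Finset (Equiv.Perm (Fin (p + q))) :=
  {σ | (∀ i j : Fin p, i < j → σ (Fin.castAdd q i) < σ (Fin.castAdd q j)) ∧
    ∀ i j : Fin q, i < j → σ (Fin.natAdd p i) < σ (Fin.natAdd p j)}

/-- The sign `(-1)^{k-i} (-1)^{|x_i| (|x_{i+1}| + ⋯ + |x_k|)}` (in 1-based numbering) of moving the
`i`-th of `k = n + 1` letters of degrees `d` to the last place. -/
def moveSign {n : ℕ} (d : Fin (n + 1) → ℤ) (i : Fin (n + 1)) : ℤˣ :=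
  ((n : ℤ) - (i : ℕ) + d i * ∑ j with i < j, d j).negOnePow

/-- A pair `p = (a, b)` with `a + b = n` stands for arities `k = a + 1`, `l = b + 1` with
`k + l = N + 1`, `N = n + 1`. -/
theorem arity {n : ℕ} (p : {p : ℕ × ℕ // p ∈ antidiagonal n}) :
    p.1.2 + 1 + p.1.1 = n + 1 := by
  have h := mem_antidiagonal.1 p.2
  omega

end Signs

section Defs

variable {K : Type*} [Field K]
  {V : Type*} [AddCommGroup V] [Module K V] {W : Type*} [AddCommGroup W] [Module K W]

/-- Families `(μ_k)_{k ≥ 1}` of linear maps `V^{⊗k} → V`; the entry at `n` is `μ_{n+1}`. -/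
abbrev Brackets (K V : Type*) [Field K] [AddCommGroup V] [Module K V] :=
  (n : ℕ) → MultilinearMap K (fun _ : Fin (n + 1) => V) V

/-- Families `(ρ_k)_{k ≥ 1}` of linear maps `V^{⊗(k-1)} ⊗ W → W`; the entry at `n` is `ρ_{n+1}`. -/
abbrev Actions (K V W : Type*) [Field K] [AddCommGroup V] [Module K V]
    [AddCommGroup W] [Module K W] :=
  (n : ℕ) → MultilinearMap K (fun _ : Fin n => V) (W →ₗ[K] W)

/-- Graded skew-symmetry of a multilinear map on the graded space `(V, 𝒢)`. -/
def IsGradedSkew {U : Type*} [AddCommGroup U] [Module K U] (𝒢 : ℤ → Submodule K V) {n : ℕ}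
    (f : MultilinearMap K (fun _ : Fin n => V) U) : Prop :=
  ∀ (d : Fin n → ℤ) (x : Fin n → V), (∀ i, x i ∈ 𝒢 (d i)) → ∀ σ : Equiv.Perm (Fin n),
    f x = (σ.sign * koszul d σ) • f (fun i => x (σ i))

/-- The `(k, l)`-part, `k = a + 1`, `l = b + 1`, of the higher Jacobi identity:
the sum over `σ ∈ Sh(l, k-1)` of
`(-1)^σ ε(σ) (-1)^{l(k-1)} μ_k (μ_l (x_{σ(1)}, …, x_{σ(l)}), x_{σ(l+1)}, …, x_{σ(N)})`. -/
def jacobiTerm (μ : Brackets K V) (a b : ℕ) (d : Fin (b + 1 + a) → ℤ)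
    (x : Fin (b + 1 + a) → V) : V :=
  ∑ σ ∈ shuffles (b + 1) a,
    (σ.sign * koszul d σ * (((b + 1) * a : ℕ) : ℤ).negOnePow) •
      μ a (Fin.cons (μ b fun i => x (σ (Fin.castAdd a i))) fun j => x (σ (Fin.natAdd (b + 1) j)))

/-- `(V, {μ_k})`, with `V = ⨁ 𝒢 i`, is an `L_∞`-algebra (with `deg μ_k = k - 2`). -/
structure IsLInfinityAlgebra (𝒢 : ℤ → Submodule K V) (μ : Brackets K V) : Prop where
  isInternal : DirectSum.IsInternal 𝒢
  degree : ∀ (n : ℕ) (d : Fin (n + 1) → ℤ) (x : Fin (n + 1) → V), (∀ i, x i ∈ 𝒢 (d i)) →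
    μ n x ∈ 𝒢 ((∑ i, d i) + ((n : ℤ) + 1 - 2))
  skew : ∀ n : ℕ, IsGradedSkew 𝒢 (μ n)
  jacobi : ∀ (n : ℕ) (d : Fin (n + 1) → ℤ) (x : Fin (n + 1) → V), (∀ i, x i ∈ 𝒢 (d i)) →
    ∑ p ∈ (antidiagonal n).attach,
      jacobiTerm μ p.1.1 p.1.2 (fun i => d (Fin.cast (arity p) i))
        (fun i => x (Fin.cast (arity p) i)) = 0

/-- The `(k, l)`-part, `k = a + 1`, `l = b + 1`, of the first sum in the representation identity:
the sum over `σ ∈ Sh(l, k-1)` with `σ(l) = N` of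
`± ρ_k (x_{σ(l+1)}, …, x_{σ(N)}, ρ_l (x_{σ(1)}, …, x_{σ(l-1)}, h))`, where `h` is the `N`-th
letter. (The entry of `x` at the last place does not occur.) -/
def repTermInner (ρ : Actions K V W) (a b : ℕ) (d : Fin (b + 1 + a) → ℤ)
    (x : Fin (b + 1 + a) → V) (h : W) : W :=
  ∑ σ ∈ shuffles (b + 1) a with (σ (Fin.castAdd a (Fin.last b)) : ℕ) = b + a,
    (σ.sign * koszul d σ * (((b + 1) * a : ℕ) : ℤ).negOnePow *
      ((a : ℤ) + ((∑ i, d (σ (Fin.castAdd a i))) + ((b : ℤ) + 1 - 2)) *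
        ∑ j, d (σ (Fin.natAdd (b + 1) j))).negOnePow) •
      ρ a (fun j => x (σ (Fin.natAdd (b + 1) j)))
        (ρ b (fun i => x (σ (Fin.castAdd a i.castSucc))) h)

/-- The `(k, l)`-part, `k = a + 1`, `l = b + 1`, of the second sum in the representation identity:
the sum over `σ ∈ Sh(l, k-1)` with `σ(N) = N` (and `N > l`) of
`± ρ_k (μ_l (x_{σ(1)}, …, x_{σ(l)}), x_{σ(l+1)}, …, x_{σ(N-1)}, h)`. -/
def repTermOuter (μ : Brackets K V) (ρ : Actions K V W) : (a b : ℕ) →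
    (Fin (b + 1 + a) → ℤ) → (Fin (b + 1 + a) → V) → W → W
  | 0, _, _, _, _ => 0
  | a + 1, b, d, x, h =>
    ∑ σ ∈ shuffles (b + 1) (a + 1) with σ (Fin.last (b + 1 + a)) = Fin.last (b + 1 + a),
      (σ.sign * koszul d σ * (((b + 1) * (a + 1) : ℕ) : ℤ).negOnePow) •
        ρ (a + 1) (Fin.cons (μ b fun i => x (σ (Fin.castAdd (a + 1) i)))
          fun j : Fin a => x (σ (Fin.natAdd (b + 1) j.castSucc))) h

/-- `{ρ_k}` is a representation of `(V, 𝒢, {μ_k})` on the graded space `W = ⨁ ℋ i`. In the identity,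
the `N`-th letter is `h`, of degree `d N`; the entry `x N` does not occur. -/
structure IsRepresentation (𝒢 : ℤ → Submodule K V) (μ : Brackets K V)
    (ℋ : ℤ → Submodule K W) (ρ : Actions K V W) : Prop where
  isInternal : DirectSum.IsInternal ℋ
  degree : ∀ (n : ℕ) (d : Fin n → ℤ) (e : ℤ) (x : Fin n → V) (h : W),
    (∀ i, x i ∈ 𝒢 (d i)) → h ∈ ℋ e → ρ n x h ∈ ℋ ((∑ i, d i) + e + ((n : ℤ) + 1 - 2))
  skew : ∀ n : ℕ, IsGradedSkew 𝒢 (ρ n)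
  identity : ∀ (n : ℕ) (d : Fin (n + 1) → ℤ) (x : Fin (n + 1) → V) (h : W),
    (∀ i, x i ∈ 𝒢 (d i)) → h ∈ ℋ (d (Fin.last n)) →
    ∑ p ∈ (antidiagonal n).attach,
        repTermInner ρ p.1.1 p.1.2 (fun i => d (Fin.cast (arity p) i))
          (fun i => x (Fin.cast (arity p) i)) h +
      ∑ p ∈ (antidiagonal n).attach,
        repTermOuter μ ρ p.1.1 p.1.2 (fun i => d (Fin.cast (arity p) i))
          (fun i => x (Fin.cast (arity p) i)) h = 0

/-- The summand for a fixed shuffle of the (first) compatibility condition, without the common sign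
`(-1)^σ ε(σ) (-1)^{l(k-1)}`. Here `k = a + 1`, `l = b + 1`; the letters in the first `l` places
are `(x i, h i)` of degree `d i`, those in the last `k - 1` places are `(x' j, h' j)` of degree
`d' j`. The six summands are, up to sign,
`μ_k (μ_l (x, …), x', …)`,
`μ_k (ψ_l (h, …, x i), x', …)`,
`ψ_k (ν_l (h, …), h', …, x' j)`,
`ψ_k (ρ_l (x, …, h i), h', …, x' j)`,
`ψ_k (h', …, μ_l (x, …))` and
`ψ_k (h', …, ψ_l (h, …, x i))`;
in the third and the fourth, the entry `h' j` is left out. -/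
def compatSummand (μ : Brackets K V) (ν : Brackets K W) (ρ : Actions K V W) (ψ : Actions K W V)
    {a b : ℕ} (d : Fin (b + 1) → ℤ) (d' : Fin a → ℤ) (x : Fin (b + 1) → V) (x' : Fin a → V)
    (h : Fin (b + 1) → W) (h' : Fin a → W) : V :=
  -- the sign of moving `x' j` behind the later ones of `h'`
  let s : Fin a → ℤˣ := fun j =>
    ((a : ℤ) - 1 - (j : ℕ) + d' j * ∑ j' with j < j', d' j').negOnePow
  -- the sign of moving the value of an operation with `l` inputs behind all of `h'`
  let t : ℤˣ := ((a : ℤ) + ((∑ i, d i) + ((b : ℤ) + 1 - 2)) * ∑ j, d' j).negOnePow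
  μ a (Fin.cons (μ b x) x') +
  ∑ i, moveSign d i • μ a (Fin.cons (ψ b (i.removeNth h) (x i)) x') +
  ∑ j, s j • ψ a (j.succ.removeNth (Fin.cons (ν b h) h' : Fin (a + 1) → W)) (x' j) +
  ∑ j, ∑ i, (moveSign d i * s j) •
    ψ a (j.succ.removeNth (Fin.cons (ρ b (i.removeNth x) (h i)) h' : Fin (a + 1) → W)) (x' j) +
  t • ψ a h' (μ b x) +
  ∑ i, (moveSign d i * t) • ψ a h' (ψ b (i.removeNth h) (x i))

/-- The `(k, l)`-part, `k = a + 1`, `l = b + 1`, of the compatibility condition. -/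
def compatTerm (μ : Brackets K V) (ν : Brackets K W) (ρ : Actions K V W) (ψ : Actions K W V)
    (a b : ℕ) (d : Fin (b + 1 + a) → ℤ) (x : Fin (b + 1 + a) → V) (h : Fin (b + 1 + a) → W) : V :=
  ∑ σ ∈ shuffles (b + 1) a,
    (σ.sign * koszul d σ * (((b + 1) * a : ℕ) : ℤ).negOnePow) •
      compatSummand μ ν ρ ψ
        (fun i => d (σ (Fin.castAdd a i))) (fun j => d (σ (Fin.natAdd (b + 1) j)))
        (fun i => x (σ (Fin.castAdd a i))) (fun j => x (σ (Fin.natAdd (b + 1) j)))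
        (fun i => h (σ (Fin.castAdd a i))) (fun j => h (σ (Fin.natAdd (b + 1) j)))

/-- A matched pair of `L_∞`-algebras. The second compatibility condition is the first one with the
two algebras and the two actions interchanged. -/
structure IsMatchedPair (𝒢 : ℤ → Submodule K V) (μ : Brackets K V)
    (ℋ : ℤ → Submodule K W) (ν : Brackets K W) (ρ : Actions K V W) (ψ : Actions K W V) :
    Prop where
  left : IsLInfinityAlgebra 𝒢 μ
  right : IsLInfinityAlgebra ℋ ν
  rep_left : IsRepresentation 𝒢 μ ℋ ρ
  rep_right : IsRepresentation ℋ ν 𝒢 ψ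
  compat_left : ∀ (n : ℕ) (d : Fin (n + 1) → ℤ) (x : Fin (n + 1) → V) (h : Fin (n + 1) → W),
    (∀ i, x i ∈ 𝒢 (d i)) → (∀ i, h i ∈ ℋ (d i)) →
    ∑ p ∈ (antidiagonal n).attach,
      compatTerm μ ν ρ ψ p.1.1 p.1.2 (fun i => d (Fin.cast (arity p) i))
        (fun i => x (Fin.cast (arity p) i)) (fun i => h (Fin.cast (arity p) i)) = 0
  compat_right : ∀ (n : ℕ) (d : Fin (n + 1) → ℤ) (x : Fin (n + 1) → V) (h : Fin (n + 1) → W),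
    (∀ i, x i ∈ 𝒢 (d i)) → (∀ i, h i ∈ ℋ (d i)) →
    ∑ p ∈ (antidiagonal n).attach,
      compatTerm ν μ ψ ρ p.1.1 p.1.2 (fun i => d (Fin.cast (arity p) i))
        (fun i => h (Fin.cast (arity p) i)) (fun i => x (Fin.cast (arity p) i)) = 0

/-- The grading of the direct sum: `(𝒢 ⊕ ℋ)^i = 𝒢^i ⊕ ℋ^i`. -/
def sumGrading (𝒢 : ℤ → Submodule K V) (ℋ : ℤ → Submodule K W) : ℤ → Submodule K (V × W) :=
  fun i => (𝒢 i).prod (ℋ i)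

/-- `μ_k ⋉ ρ_k`, evaluated at pairs `(x i, h i)` that are homogeneous of degree `d i`. -/
def ltimes (μ : Brackets K V) (ρ : Actions K V W) (n : ℕ) (d : Fin (n + 1) → ℤ)
    (x : Fin (n + 1) → V) (h : Fin (n + 1) → W) : V × W :=
  (μ n x, ∑ i, moveSign d i • ρ n (i.removeNth x) (h i))

/-- `ψ_k ⋊ ν_k`, evaluated at pairs `(x i, h i)` that are homogeneous of degree `d i`. -/
def rtimes (ψ : Actions K W V) (ν : Brackets K W) (n : ℕ) (d : Fin (n + 1) → ℤ)
    (x : Fin (n + 1) → V) (h : Fin (n + 1) → W) : V × W :=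
  (∑ i, moveSign d i • ψ n (i.removeNth h) (x i), ν n h)

/-- `l_k = μ_k ⋉ ρ_k + ψ_k ⋊ ν_k` for all `k ≥ 1`, on homogeneous elements (hence everywhere, by
multilinearity). -/
def IsBicrossed (𝒢 : ℤ → Submodule K V) (μ : Brackets K V) (ℋ : ℤ → Submodule K W)
    (ν : Brackets K W) (ρ : Actions K V W) (ψ : Actions K W V) (l : Brackets K (V × W)) : Prop :=
  ∀ (n : ℕ) (d : Fin (n + 1) → ℤ) (z : Fin (n + 1) → V × W),
    (∀ i, z i ∈ sumGrading 𝒢 ℋ (d i)) →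
    l n z = ltimes μ ρ n d (fun i => (z i).1) (fun i => (z i).2) +
      rtimes ψ ν n d (fun i => (z i).1) (fun i => (z i).2)

end Defs

section Lie

variable (K : Type*) [Field K]

/-- The grading that is concentrated in degree `0`. -/
def degreeZero (V : Type*) [AddCommGroup V] [Module K V] : ℤ → Submodule K V :=
  fun i => if i = 0 then ⊤ else ⊥

/-- A Lie bracket as a family with `μ_2 = [ , ]` and `μ_k = 0` for `k ≠ 2`. -/
def lieBrackets (g : Type*) [LieRing g] [LieAlgebra K g] : Brackets K g
  | 1 => LinearMap.uncurryLeft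
      ((MultilinearMap.ofSubsingletonₗ K K g g (0 : Fin 1)).toLinearMap ∘ₗ
        LinearMap.mk₂ K (fun x y : g => ⁅x, y⁆) add_lie smul_lie lie_add
          (fun c x y => lie_smul c x y))
  | _ => 0

variable {K}

/-- An action of a Lie algebra as a family with `ρ_2 (x, h) = ρ_x h` and `ρ_k = 0` for `k ≠ 2`. -/
def lieActions {g h : Type*} [LieRing g] [LieAlgebra K g] [LieRing h] [LieAlgebra K h]
    (ρ : g →ₗ[K] Module.End K h) : Actions K g h
  | 1 => MultilinearMap.ofSubsingleton K g (Module.End K h) (0 : Fin 1) ρ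
  | _ => 0

theorem lieBrackets_one (g : Type*) [LieRing g] [LieAlgebra K g] (x : Fin 2 → g) :
    lieBrackets K g 1 x = ⁅x 0, x 1⁆ := rfl

theorem lieActions_one {g h : Type*} [LieRing g] [LieAlgebra K g] [LieRing h] [LieAlgebra K h]
    (ρ : g →ₗ[K] Module.End K h) (x : Fin 1 → g) (u : h) : lieActions ρ 1 x u = ρ (x 0) u := rfl

/-- A matched pair of Lie algebras. -/
structure IsLieMatchedPair {g h : Type*} [LieRing g] [LieAlgebra K g] [LieRing h] [LieAlgebra K h]
    (ρ : g →ₗ[K] Module.End K h) (ψ : h →ₗ[K] Module.End K g) : Prop where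
  rep_left : ∀ (x y : g) (u : h), ρ ⁅x, y⁆ u = ρ x (ρ y u) - ρ y (ρ x u)
  rep_right : ∀ (u v : h) (x : g), ψ ⁅u, v⁆ x = ψ u (ψ v x) - ψ v (ψ u x)
  compat_left : ∀ (x : g) (u v : h),
    ρ x ⁅u, v⁆ = ⁅ρ x u, v⁆ + ⁅u, ρ x v⁆ + ρ (ψ v x) u - ρ (ψ u x) v
  compat_right : ∀ (u : h) (x y : g),
    ψ u ⁅x, y⁆ = ⁅ψ u x, y⁆ + ⁅x, ψ u y⁆ + ψ (ρ y u) x - ψ (ρ x u) y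

end Lie

end LInf

namespace LInf

/-! ### Graded direct sums and multilinear maps prescribed on homogeneous elements. -/

section Grading

variable {K : Type*} [Field K]
  {V : Type*} [AddCommGroup V] [Module K V] {W : Type*} [AddCommGroup W] [Module K W]

/-! The Jacobi identity of the bicrossed product is the pair of compatibility conditions, read
componentwise. Indeed, expand the `V`-component of `l_k (l_l (z, …), z', …)` by multilinearity. The
inner value has a `V`-part (from `μ_l` and `ψ_l`) and a `W`-part (from `ν_l` and `ρ_l`), and each
part enters `μ_k` or `ψ_k`; this yields exactly the six kinds of terms in `compatSummand`, with
matching signs (`eq_compatSummand`). The `W`-component is the same with the roles interchanged.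

It remains to see that `l` exists and is graded skew-symmetric. The defining formula carries
degree-dependent signs, so it is not visibly multilinear; `exists_multilinearMap_move` realizes
these signs by linear parity operators. Uniqueness holds since homogeneous elements span.
Skew-symmetry reduces to a sign identity, `sign_mul_koszul_mul_moveSign`, comparing a permutation
with the one it induces after one letter is deleted.

For Lie algebras in degree `0` the Koszul signs are trivial and only `k = l = 2` contributes. Each
identity is then a sum over at most three `(2, 1)`-shuffles and follows from the Lie axioms. -/

theorem units_smul_eq (K : Type*) [Field K] {V : Type*} [AddCommGroup V] [Module K V] (u : ℤˣ)
    (v : V) : u • v = ((u : ℤ) : K) • v := by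
  rw [Units.smul_def, Int.cast_smul_eq_zsmul]

/-- The linear map that multiplies the component of degree `i` by `c i`. -/
theorem exists_linearMap_smul {𝒢 : ℤ → Submodule K V} (hG : DirectSum.IsInternal 𝒢) (c : ℤ → K) :
    ∃ φ : V →ₗ[K] V, ∀ i, ∀ x ∈ 𝒢 i, φ x = c i • x := by
  classical
  let e := LinearEquiv.ofBijective (DirectSum.coeLinearMap 𝒢) hG
  refine ⟨(DirectSum.toModule K ℤ V fun i => c i • (𝒢 i).subtype) ∘ₗ e.symm.toLinearMap,
    fun i x hx => ?_⟩
  have h : e.symm x = DirectSum.lof K ℤ (fun i => 𝒢 i) i ⟨x, hx⟩ := by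
    rw [LinearEquiv.symm_apply_eq]
    exact (DirectSum.coeLinearMap_lof 𝒢 i ⟨x, hx⟩).symm
  simp [h]

theorem isInternal_sumGrading {𝒢 : ℤ → Submodule K V} {ℋ : ℤ → Submodule K W}
    (hG : DirectSum.IsInternal 𝒢) (hH : DirectSum.IsInternal ℋ) :
    DirectSum.IsInternal (sumGrading 𝒢 ℋ) := by
  rw [DirectSum.isInternal_submodule_iff_iSupIndep_and_iSup_eq_top]
  constructor
  · intro i
    -- The projections to degree `i` kill every other summand and fix this one, so the intersection
    -- is zero.
    obtain ⟨φ, hφ⟩ := exists_linearMap_smul hG (fun j => if j = i then 1 else 0)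
    obtain ⟨θ, hθ⟩ := exists_linearMap_smul hH (fun j => if j = i then 1 else 0)
    have hker : ⨆ j, ⨆ (_ : j ≠ i), sumGrading 𝒢 ℋ j ≤ LinearMap.ker (φ.prodMap θ) := by
      refine iSup₂_le fun j hj z hz => ?_
      simp [hφ j _ hz.1, hθ j _ hz.2, hj]
    rw [Submodule.disjoint_def]
    intro z hz hz'
    have h := LinearMap.mem_ker.1 (hker hz')
    rw [LinearMap.prodMap_apply, hφ i _ hz.1, hθ i _ hz.2] at h
    simpa using h
  · rw [eq_top_iff]
    rintro ⟨x, h⟩ -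
    have hx : LinearMap.inl K V W x ∈ ⨆ i, sumGrading 𝒢 ℋ i := by
      have : (⨆ i, 𝒢 i) ≤ (⨆ i, sumGrading 𝒢 ℋ i).comap (LinearMap.inl K V W) :=
        iSup_le fun i y hy => Submodule.mem_iSup_of_mem i ⟨hy, zero_mem _⟩
      exact this (hG.submodule_iSup_eq_top ▸ Submodule.mem_top)
    have hh : LinearMap.inr K V W h ∈ ⨆ i, sumGrading 𝒢 ℋ i := by
      have : (⨆ i, ℋ i) ≤ (⨆ i, sumGrading 𝒢 ℋ i).comap (LinearMap.inr K V W) :=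
        iSup_le fun i y hy => Submodule.mem_iSup_of_mem i ⟨zero_mem _, hy⟩
      exact this (hH.submodule_iSup_eq_top ▸ Submodule.mem_top)
    simpa using add_mem hx hh

/-- Multilinear maps that agree on homogeneous elements are equal. -/
theorem multilinearMap_ext_homogeneous {ι : Type*} [Fintype ι] {𝒢 : ℤ → Submodule K V}
    (hG : DirectSum.IsInternal 𝒢) {f g : MultilinearMap K (fun _ : ι => V) W}
    (hfg : ∀ (d : ι → ℤ) (x : ι → V), (∀ i, x i ∈ 𝒢 (d i)) → f x = g x) : f = g := by
  classical
  -- Induction on the set `s` of slots in which the argument need not be homogeneous.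
  have key : ∀ s : Finset ι, ∀ x : ι → V, (∀ i ∉ s, ∃ d, x i ∈ 𝒢 d) → f x = g x := by
    intro s
    induction s using Finset.induction_on with
    | empty =>
      intro x hx
      choose d hd using fun i => hx i (by simp)
      exact hfg d x hd
    | insert a s ha ih =>
      intro x hx
      have h : ∀ y : V, f (Function.update x a y) = g (Function.update x a y) := by
        intro y
        have hy : y ∈ ⨆ i, 𝒢 i := hG.submodule_iSup_eq_top ▸ Submodule.mem_top
        induction hy using Submodule.iSup_induction' with
        | mem i y hy =>
          refine ih _ fun j hj => ?_
          by_cases hja : j = a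
          · subst hja
            exact ⟨i, by simpa using hy⟩
          · rw [Function.update_of_ne hja]
            exact hx j (by simp [hj, hja])
        | zero => simp
        | add y z _ _ hy hz => simp [hy, hz]
      simpa using h (x a)
  ext x
  exact key univ x (by simp)

/-- `z ↦ f (…, z_{i-1}, z_{i+1}, …) (z_i)` with linear maps applied to the arguments. -/
def insertAction {U : Type*} [AddCommGroup U] [Module K U] {n : ℕ} (i : Fin (n + 1))
    (f : MultilinearMap K (fun _ : Fin n => W) (V →ₗ[K] V)) (p : U →ₗ[K] V)
    (q : Fin n → U →ₗ[K] W) : MultilinearMap K (fun _ : Fin (n + 1) => U) V :=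
  LinearMap.uncurryMid i
    { toFun := fun u => (LinearMap.applyₗ (p u)).compMultilinearMap (f.compLinearMap q)
      map_add' := fun u v => by ext; simp
      map_smul' := fun c u => by ext; simp }

theorem insertAction_apply {U : Type*} [AddCommGroup U] [Module K U] {n : ℕ} (i : Fin (n + 1))
    (f : MultilinearMap K (fun _ : Fin n => W) (V →ₗ[K] V)) (p : U →ₗ[K] V)
    (q : Fin n → U →ₗ[K] W) (z : Fin (n + 1) → U) :
    insertAction i f p q z = f (fun j => q j (z (i.succAbove j))) (p (z i)) := rfl

theorem negOnePow_sum {ι : Type*} (s : Finset ι) (f : ι → ℤ) :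
    (∑ i ∈ s, f i).negOnePow = ∏ i ∈ s, (f i).negOnePow := by
  classical
  induction s using Finset.induction_on with
  | empty => simp
  | insert a s ha ih => rw [sum_insert ha, prod_insert ha, Int.negOnePow_add, ih]

/-- The Koszul part of the sign depends on the moved letter only through its parity. If that letter
is even there is no sign; if it is odd, each later letter contributes its own parity sign, which is
a linear operator on that letter. Splitting the moved letter into even and odd parts thus gives a
multilinear formula. -/
theorem exists_multilinearMap_move {U : Type*} [AddCommGroup U] [Module K U]
    {𝒢 : ℤ → Submodule K V} {ℋ : ℤ → Submodule K W}
    (hG : DirectSum.IsInternal 𝒢) (hH : DirectSum.IsInternal ℋ) {n : ℕ} (i : Fin (n + 1))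
    (f : MultilinearMap K (fun _ : Fin n => W) (V →ₗ[K] V)) (p : U →ₗ[K] V) (q : U →ₗ[K] W) :
    ∃ F : MultilinearMap K (fun _ : Fin (n + 1) => U) V, ∀ (d : Fin (n + 1) → ℤ)
      (z : Fin (n + 1) → U), (∀ j, p (z j) ∈ 𝒢 (d j)) → (∀ j, q (z j) ∈ ℋ (d j)) →
      F z = moveSign d i • f (i.removeNth fun j => q (z j)) (p (z i)) := by
  -- `E` and `O` project to the even and odd parts; `P` multiplies degree `j` by `(-1)^j`.
  obtain ⟨E, hE⟩ := exists_linearMap_smul hG (fun j => if Even j then 1 else 0)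
  obtain ⟨O, hO⟩ := exists_linearMap_smul hG (fun j => if Even j then 0 else 1)
  obtain ⟨P, hP⟩ := exists_linearMap_smul hH (fun j => ((j.negOnePow : ℤ) : K))
  refine ⟨((((n : ℤ) - (i : ℕ)).negOnePow : ℤ) : K) • (insertAction i f (E ∘ₗ p) (fun _ => q) +
    insertAction i f (O ∘ₗ p) (fun j => if i < i.succAbove j then P ∘ₗ q else q)),
    fun d z hz hz' => ?_⟩
  have hcomm : ∀ j, (if i < i.succAbove j then P ∘ₗ q else q) (z (i.succAbove j)) =
      (if i < i.succAbove j then (((d (i.succAbove j)).negOnePow : ℤ) : K) else 1) •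
        q (z (i.succAbove j)) := by
    intro j
    split_ifs
    · exact hP _ _ (hz' _)
    · simp
  have hprod : (∑ j with i < j, d j).negOnePow =
      ∏ j : Fin n, if i < i.succAbove j then (d (i.succAbove j)).negOnePow else 1 := by
    rw [negOnePow_sum, prod_filter, Fin.prod_univ_succAbove _ i]
    simp
  have hprodK : (((∑ j with i < j, d j).negOnePow : ℤ) : K) =
      ∏ j : Fin n, if i < i.succAbove j then (((d (i.succAbove j)).negOnePow : ℤ) : K) else 1 := by
    rw [hprod]
    push_cast
    refine prod_congr rfl fun j _ => ?_
    split_ifs <;> simp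
  rw [units_smul_eq K, moveSign, Int.negOnePow_add]
  simp only [smul_apply, add_apply, insertAction_apply, hcomm,
    LinearMap.comp_apply, hE _ _ (hz i), hO _ _ (hz i), MultilinearMap.map_smul_univ, ← hprodK,
    Units.val_mul, Int.cast_mul, mul_smul]
  congr 1
  -- On homogeneous input exactly one of the two insertions survives.
  by_cases h : Even (d i)
  · simp only [h, if_true, one_smul, zero_smul, map_zero, add_zero]
    rw [Int.negOnePow_even _ (h.mul_right _)]
    simp only [Units.val_one, Int.cast_one, one_smul]
    rfl
  · have h' : (d i * ∑ j with i < j, d j).negOnePow = (∑ j with i < j, d j).negOnePow := by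
      rw [Int.negOnePow_eq_iff]
      rw [Int.not_even_iff_odd] at h
      rw [Int.even_sub]
      simp [Int.even_mul, Int.not_even_iff_odd.2 h]
    simp only [h, if_false, one_smul, zero_smul, map_zero, zero_add, h']
    rfl

theorem exists_isBicrossed {𝒢 : ℤ → Submodule K V} (μ : Brackets K V) {ℋ : ℤ → Submodule K W}
    (ν : Brackets K W) (ρ : Actions K V W) (ψ : Actions K W V)
    (hG : DirectSum.IsInternal 𝒢) (hH : DirectSum.IsInternal ℋ) :
    ∃ l : Brackets K (V × W), IsBicrossed 𝒢 μ ℋ ν ρ ψ l := by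
  choose F hF using fun (n : ℕ) (i : Fin (n + 1)) =>
    exists_multilinearMap_move hG hH i (ψ n) (LinearMap.fst K V W) (LinearMap.snd K V W)
  choose G hG using fun (n : ℕ) (i : Fin (n + 1)) =>
    exists_multilinearMap_move hH hG i (ρ n) (LinearMap.snd K V W) (LinearMap.fst K V W)
  refine ⟨fun n => MultilinearMap.prod
    ((μ n).compLinearMap (fun _ => LinearMap.fst K V W) + ∑ i, F n i)
    ((ν n).compLinearMap (fun _ => LinearMap.snd K V W) + ∑ i, G n i), fun n d z hz => ?_⟩
  have h1 := fun i => hF n i d z (fun j => (hz j).1) (fun j => (hz j).2)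
  have h2 := fun i => hG n i d z (fun j => (hz j).2) (fun j => (hz j).1)
  simp only [LinearMap.fst_apply, LinearMap.snd_apply] at h1 h2
  simp [ltimes, rtimes, h1, h2, add_comm]

theorem isBicrossed_unique {𝒢 : ℤ → Submodule K V} {μ : Brackets K V} {ℋ : ℤ → Submodule K W}
    {ν : Brackets K W} {ρ : Actions K V W} {ψ : Actions K W V}
    (hG : DirectSum.IsInternal 𝒢) (hH : DirectSum.IsInternal ℋ) {l l' : Brackets K (V × W)}
    (h : IsBicrossed 𝒢 μ ℋ ν ρ ψ l) (h' : IsBicrossed 𝒢 μ ℋ ν ρ ψ l') : l' = l := by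
  funext n
  have hI : DirectSum.IsInternal (sumGrading 𝒢 ℋ) := isInternal_sumGrading hG hH
  refine multilinearMap_ext_homogeneous (𝒢 := sumGrading 𝒢 ℋ) hI fun d z hz => ?_
  rw [h' n d z hz, h n d z hz]

end Grading

/-! ### Signs in the graded exterior algebra. -/

section SkewSigns

/-- The sign of interchanging two neighbouring letters of degrees `a` and `b` in the graded
exterior algebra. -/
def swapSign (a b : ℤ) : ℤˣ := -(a * b).negOnePow

theorem swapSign_comm (a b : ℤ) : swapSign a b = swapSign b a := by
  rw [swapSign, swapSign, mul_comm]

/-- Signature and Koszul sign are both products over inversions, so together they contribute one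
`swapSign` per inversion. -/
theorem sign_mul_koszul {N : ℕ} (d : Fin N → ℤ) (σ : Equiv.Perm (Fin N)) :
    σ.sign * koszul d σ =
      ∏ p, ∏ q, if p < q ∧ σ q < σ p then swapSign (d (σ p)) (d (σ q)) else 1 := by
  rw [Equiv.Perm.sign_eq_prod_prod_Ioi, koszul, ← prod_mul_distrib]
  refine prod_congr rfl fun p _ => ?_
  rw [← filter_lt_eq_Ioi, prod_filter, prod_filter, ← prod_mul_distrib]
  refine prod_congr rfl fun q _ => ?_
  by_cases h : p < q
  · have hne : σ q ≠ σ p := fun e => h.ne' (σ.injective e)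
    rcases lt_or_gt_of_ne hne with h' | h'
    · simp [h, h', h'.not_gt, swapSign]
    · simp [h, h', h'.not_gt]
  · simp [h]

theorem moveSign_eq_prod {n : ℕ} (d : Fin (n + 1) → ℤ) (i : Fin (n + 1)) :
    moveSign d i = ∏ j, if i < j then swapSign (d i) (d j) else 1 := by
  have hc : #{j | i < j} = n - i := by
    rw [filter_lt_eq_Ioi, Fin.card_Ioi]
    omega
  rw [← prod_filter, moveSign, mul_sum, Int.negOnePow_add, negOnePow_sum]
  simp only [swapSign]
  rw [prod_neg, hc]
  congr 1
  rw [← Nat.cast_sub (by omega), Int.negOnePow_def, zpow_natCast]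

/-- The permutation induced by `σ` on the complements of `i` and `σ i`. -/
theorem exists_perm_succAbove {n : ℕ} (σ : Equiv.Perm (Fin (n + 1))) (i : Fin (n + 1)) :
    ∃ τ : Equiv.Perm (Fin n), ∀ j, σ (i.succAbove j) = (σ i).succAbove (τ j) := by
  have h : ∀ j, ∃ k, (σ i).succAbove k = σ (i.succAbove j) := fun j =>
    Fin.exists_succAbove_eq fun e => Fin.succAbove_ne i j (σ.injective e)
  choose t ht using h
  have hinj : Function.Injective t := fun a b hab => by
    have := ht a
    rw [hab, ht b] at this
    exact (Fin.succAbove_right_injective (σ.injective this)).symm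
  exact ⟨Equiv.ofBijective t (Finite.injective_iff_bijective.1 hinj), fun j => (ht j).symm⟩

/-- Moving a letter to the end after permuting equals moving it first and then permuting the others.
Pairs of positions avoiding `i` give the inversions of `τ`. For a pair `{i, j}`, the conditions
"inverted by `σ`" and `i < j` add up modulo 2 to `σ i < σ j`, and the swap sign squares to `1`. -/
theorem sign_mul_koszul_mul_moveSign {n : ℕ} (d : Fin (n + 1) → ℤ) (σ : Equiv.Perm (Fin (n + 1)))
    (i : Fin (n + 1)) (τ : Equiv.Perm (Fin n))
    (hτ : ∀ j, σ (i.succAbove j) = (σ i).succAbove (τ j)) :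
    σ.sign * koszul d σ * moveSign (fun j => d (σ j)) i =
      moveSign d (σ i) * (τ.sign * koszul ((σ i).removeNth d) τ) := by
  have hm : moveSign d (σ i) =
      ∏ j, if σ i < σ (i.succAbove j) then swapSign (d (σ i)) (d (σ (i.succAbove j))) else 1 := by
    rw [moveSign_eq_prod, ← Equiv.prod_comp σ, Fin.prod_univ_succAbove _ i]
    simp
  have hm' : moveSign (fun j => d (σ j)) i =
      ∏ j, if i < i.succAbove j then swapSign (d (σ i)) (d (σ (i.succAbove j))) else 1 := by
    rw [moveSign_eq_prod, Fin.prod_univ_succAbove _ i]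
    simp
  rw [sign_mul_koszul, sign_mul_koszul, hm, hm', Fin.prod_univ_succAbove _ i,
    Fin.prod_univ_succAbove _ i]
  simp_rw [Fin.prod_univ_succAbove _ i, prod_mul_distrib]
  simp only [lt_self_iff_false, false_and, if_false, one_mul]
  -- The pairs avoiding `i`: `succAbove` is increasing, so inversions of `σ` there are those of `τ`.
  have h3 : (∏ j, ∏ k, if i.succAbove j < i.succAbove k ∧ σ (i.succAbove k) < σ (i.succAbove j)
        then swapSign (d (σ (i.succAbove j))) (d (σ (i.succAbove k))) else 1) =
      ∏ j, ∏ k, if j < k ∧ τ k < τ j then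
        swapSign ((σ i).removeNth d (τ j)) ((σ i).removeNth d (τ k)) else 1 := by
    simp only [hτ, Fin.succAbove_lt_succAbove_iff, Fin.removeNth_apply]
  rw [h3, mul_right_comm, ← mul_assoc]
  rw [mul_right_comm]
  rw [mul_right_comm _ (∏ j, ∏ k, _)]
  congr 1
  rw [← prod_mul_distrib, ← prod_mul_distrib]
  refine prod_congr rfl fun j _ => ?_
  have h1 : i.succAbove j ≠ i := Fin.succAbove_ne i j
  have h2 : σ (i.succAbove j) ≠ σ i := fun e => h1 (σ.injective e)
  rw [swapSign_comm (d (σ (i.succAbove j)))]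
  rcases lt_or_gt_of_ne h1 with h1 | h1 <;> rcases lt_or_gt_of_ne h2 with h2 | h2 <;>
    simp [h1, h2, h1.not_gt, h2.not_gt, ← sq, Int.units_sq]

end SkewSigns

/-! ### The bicrossed product is an `L_∞`-algebra. -/

section Bicrossed

variable {K : Type*} [Field K]
  {V : Type*} [AddCommGroup V] [Module K V] {W : Type*} [AddCommGroup W] [Module K W]

theorem map_units_smul (f : V →ₗ[K] W) (u : ℤˣ) (v : V) : f (u • v) = u • f v := by
  rw [Units.smul_def, Units.smul_def, map_zsmul]

theorem units_smul_mem (p : Submodule K V) (u : ℤˣ) {v : V} (hv : v ∈ p) : u • v ∈ p := by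
  rw [units_smul_eq K]
  exact p.smul_mem _ hv

theorem units_smul_apply (f : V →ₗ[K] W) (u : ℤˣ) (v : V) : (u • f) v = u • f v := rfl

theorem sum_moveSign_mem {𝒢 : ℤ → Submodule K V} {ℋ : ℤ → Submodule K W} {n : ℕ}
    {f : MultilinearMap K (fun _ : Fin n => W) (V →ₗ[K] V)}
    (hf : ∀ (d : Fin n → ℤ) (e : ℤ) (h : Fin n → W) (x : V),
      (∀ i, h i ∈ ℋ (d i)) → x ∈ 𝒢 e → f h x ∈ 𝒢 ((∑ i, d i) + e + ((n : ℤ) + 1 - 2)))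
    {d : Fin (n + 1) → ℤ} {x : Fin (n + 1) → V} {h : Fin (n + 1) → W}
    (hx : ∀ i, x i ∈ 𝒢 (d i)) (hh : ∀ i, h i ∈ ℋ (d i)) :
    ∑ i, moveSign d i • f (i.removeNth h) (x i) ∈ 𝒢 ((∑ i, d i) + ((n : ℤ) + 1 - 2)) := by
  refine sum_mem fun i _ => units_smul_mem _ _ ?_
  rw [Fin.sum_univ_succAbove d i, add_comm (d i)]
  exact hf (i.removeNth d) (d i) _ _ (fun j => hh _) (hx i)

/-- After reindexing by `σ`, the summands match one by one: skew-symmetry of `f` is applied to the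
permutation induced on the letters other than the distinguished one. -/
theorem sum_moveSign_skew {𝒢 : ℤ → Submodule K V} {n : ℕ}
    {f : MultilinearMap K (fun _ : Fin n => V) (W →ₗ[K] W)} (hf : IsGradedSkew 𝒢 f)
    {d : Fin (n + 1) → ℤ} {x : Fin (n + 1) → V} (h : Fin (n + 1) → W)
    (hx : ∀ i, x i ∈ 𝒢 (d i)) (σ : Equiv.Perm (Fin (n + 1))) :
    ∑ i, moveSign d i • f (i.removeNth x) (h i) =
      (σ.sign * koszul d σ) • ∑ i, moveSign (fun j => d (σ j)) i •
        f (i.removeNth fun j => x (σ j)) (h (σ i)) := by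
  rw [smul_sum, ← Equiv.sum_comp σ]
  refine sum_congr rfl fun i _ => ?_
  obtain ⟨τ, hτ⟩ := exists_perm_succAbove σ i
  rw [smul_smul, sign_mul_koszul_mul_moveSign d σ i τ hτ,
    hf ((σ i).removeNth d) ((σ i).removeNth x) (fun j => hx _) τ, units_smul_apply, smul_smul]
  simp only [Fin.removeNth_apply, ← hτ]
  rfl

theorem exists_linearMap_cons {U : Type*} [AddCommGroup U] [Module K U] {a : ℕ}
    (f : MultilinearMap K (fun _ : Fin (a + 1) => W) U) (h' : Fin a → W) :
    ∃ L : W →ₗ[K] U, ∀ y, f (Fin.cons y h') = L y :=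
  ⟨f.toLinearMap (Fin.cons 0 h') 0, fun y => by
    rw [MultilinearMap.toLinearMap_apply, Fin.update_cons_zero]⟩

theorem exists_linearMap_removeNth_cons {U : Type*} [AddCommGroup U] [Module K U] {a : ℕ}
    (f : MultilinearMap K (fun _ : Fin a => W) U) (h' : Fin a → W) (j : Fin a) :
    ∃ L : W →ₗ[K] U, ∀ y, f (j.succ.removeNth (Fin.cons y h' : Fin (a + 1) → W)) = L y := by
  cases a with
  | zero => exact j.elim0
  | succ a =>
    obtain ⟨L, hL⟩ := exists_linearMap_cons f (j.removeNth h')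
    refine ⟨L, fun y => ?_⟩
    rw [← hL, ← Fin.cons_comp_succ_succAbove]
    rfl

/-- The summand of the compatibility condition is a component of the composition of the operations
of the bicrossed product. -/
theorem eq_compatSummand (μ : Brackets K V) (ν : Brackets K W) (ρ : Actions K V W)
    (ψ : Actions K W V) {a b : ℕ} (d : Fin (b + 1) → ℤ) (d' : Fin a → ℤ) (x : Fin (b + 1) → V)
    (x' : Fin a → V) (h : Fin (b + 1) → W) (h' : Fin a → W) (X : V) (Y : W)
    (hX : X = μ b x + ∑ i, moveSign d i • ψ b (i.removeNth h) (x i))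
    (hY : Y = ν b h + ∑ i, moveSign d i • ρ b (i.removeNth x) (h i)) :
    μ a (Fin.cons X x') +
      ∑ i, moveSign (Fin.cons ((∑ i, d i) + ((b : ℤ) + 1 - 2)) d') i •
        ψ a (i.removeNth (Fin.cons Y h' : Fin (a + 1) → W))
          ((Fin.cons X x' : Fin (a + 1) → V) i) =
      compatSummand μ ν ρ ψ d d' x x' h h' := by
  -- Slot `0` holds the inner value, so its sign is the `t` of `compatSummand`; the later slots give
  -- `s`.
  have h0 : moveSign (Fin.cons ((∑ i, d i) + ((b : ℤ) + 1 - 2)) d') (0 : Fin (a + 1)) =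
      ((a : ℤ) + ((∑ i, d i) + ((b : ℤ) + 1 - 2)) * ∑ j, d' j).negOnePow := by
    simp [moveSign, sum_filter, Fin.sum_univ_succ]
  have h1 : ∀ j : Fin a, moveSign (Fin.cons ((∑ i, d i) + ((b : ℤ) + 1 - 2)) d') j.succ =
      ((a : ℤ) - 1 - (j : ℕ) + d' j * ∑ j' with j < j', d' j').negOnePow := by
    intro j
    have : (a : ℤ) - 1 - (j : ℕ) = (a : ℤ) - ((j : ℕ) + 1) := by ring
    simp [moveSign, sum_filter, Fin.sum_univ_succ, this]
  -- The outer operations are needed only as linear functions of the inner value; `X` and `Y` can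
  -- then be expanded.
  obtain ⟨M, hM⟩ := exists_linearMap_cons (μ a) x'
  choose L hL using exists_linearMap_removeNth_cons (ψ a) h'
  rw [Fin.sum_univ_succ, h0]
  simp only [h1, Fin.cons_zero, Fin.cons_succ, Fin.removeNth_zero, Fin.tail_cons, hL, hM,
    compatSummand, hX, hY, map_add, map_sum, map_units_smul, LinearMap.add_apply,
    LinearMap.sum_apply, units_smul_apply, smul_add, smul_sum, smul_smul, sum_add_distrib]
  simp only [mul_comm]
  abel

variable {𝒢 : ℤ → Submodule K V} {μ : Brackets K V} {ℋ : ℤ → Submodule K W}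
    {ν : Brackets K W} {ρ : Actions K V W} {ψ : Actions K W V} {l : Brackets K (V × W)}

theorem IsBicrossed.fst (hl : IsBicrossed 𝒢 μ ℋ ν ρ ψ l) {n : ℕ} {d : Fin (n + 1) → ℤ}
    {z : Fin (n + 1) → V × W} (hz : ∀ i, z i ∈ sumGrading 𝒢 ℋ (d i)) :
    (l n z).1 = μ n (fun i => (z i).1) +
      ∑ i, moveSign d i • ψ n (i.removeNth fun j => (z j).2) (z i).1 := by
  rw [hl n d z hz]
  rfl

theorem IsBicrossed.snd (hl : IsBicrossed 𝒢 μ ℋ ν ρ ψ l) {n : ℕ} {d : Fin (n + 1) → ℤ}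
    {z : Fin (n + 1) → V × W} (hz : ∀ i, z i ∈ sumGrading 𝒢 ℋ (d i)) :
    (l n z).2 = ν n (fun i => (z i).2) +
      ∑ i, moveSign d i • ρ n (i.removeNth fun j => (z j).1) (z i).2 := by
  rw [hl n d z hz]
  exact add_comm _ _

theorem IsBicrossed.mem (hP : IsMatchedPair 𝒢 μ ℋ ν ρ ψ) (hl : IsBicrossed 𝒢 μ ℋ ν ρ ψ l)
    {n : ℕ} {d : Fin (n + 1) → ℤ} {z : Fin (n + 1) → V × W}
    (hz : ∀ i, z i ∈ sumGrading 𝒢 ℋ (d i)) :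
    l n z ∈ sumGrading 𝒢 ℋ ((∑ i, d i) + ((n : ℤ) + 1 - 2)) := by
  constructor
  · rw [hl.fst hz]
    exact add_mem (hP.left.degree n d _ fun i => (hz i).1)
      (sum_moveSign_mem (hP.rep_right.degree n) (fun i => (hz i).1) (fun i => (hz i).2))
  · rw [hl.snd hz]
    exact add_mem (hP.right.degree n d _ fun i => (hz i).2)
      (sum_moveSign_mem (hP.rep_left.degree n) (fun i => (hz i).2) (fun i => (hz i).1))

theorem IsBicrossed.skew (hP : IsMatchedPair 𝒢 μ ℋ ν ρ ψ) (hl : IsBicrossed 𝒢 μ ℋ ν ρ ψ l)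
    (n : ℕ) : IsGradedSkew (sumGrading 𝒢 ℋ) (l n) := by
  intro d z hz σ
  ext
  · rw [Prod.smul_fst, hl.fst hz, hl.fst (d := fun i => d (σ i)) fun i => hz (σ i), smul_add,
      ← sum_moveSign_skew (hP.rep_right.skew n) (fun i => (z i).1) (fun i => (hz i).2) σ,
      hP.left.skew n d _ (fun i => (hz i).1) σ]
  · rw [Prod.smul_snd, hl.snd hz, hl.snd (d := fun i => d (σ i)) fun i => hz (σ i), smul_add,
      ← sum_moveSign_skew (hP.rep_left.skew n) (fun i => (z i).2) (fun i => (hz i).1) σ,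
      hP.right.skew n d _ (fun i => (hz i).2) σ]

theorem cons_mem_sumGrading (hP : IsMatchedPair 𝒢 μ ℋ ν ρ ψ) (hl : IsBicrossed 𝒢 μ ℋ ν ρ ψ l)
    {a b : ℕ} {d : Fin (b + 1) → ℤ} {d' : Fin a → ℤ} {z : Fin (b + 1) → V × W}
    {z' : Fin a → V × W} (hz : ∀ i, z i ∈ sumGrading 𝒢 ℋ (d i))
    (hz' : ∀ i, z' i ∈ sumGrading 𝒢 ℋ (d' i)) (i : Fin (a + 1)) :
    (Fin.cons (l b z) z' : Fin (a + 1) → V × W) i ∈ sumGrading 𝒢 ℋ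
      ((Fin.cons ((∑ i, d i) + ((b : ℤ) + 1 - 2)) d' : Fin (a + 1) → ℤ) i) := by
  cases i using Fin.cases with
  | zero => exact hl.mem hP hz
  | succ i => exact hz' i

theorem comp_cons {X Y : Type*} (f : X → Y) {a : ℕ} (x : X) (x' : Fin a → X) :
    (fun i => f ((Fin.cons x x' : Fin (a + 1) → X) i)) = Fin.cons (f x) fun i => f (x' i) := by
  ext i
  cases i using Fin.cases <;> rfl

theorem IsBicrossed.comp_fst (hP : IsMatchedPair 𝒢 μ ℋ ν ρ ψ) (hl : IsBicrossed 𝒢 μ ℋ ν ρ ψ l)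
    {a b : ℕ} {d : Fin (b + 1) → ℤ} {d' : Fin a → ℤ} {z : Fin (b + 1) → V × W}
    {z' : Fin a → V × W} (hz : ∀ i, z i ∈ sumGrading 𝒢 ℋ (d i))
    (hz' : ∀ i, z' i ∈ sumGrading 𝒢 ℋ (d' i)) :
    (l a (Fin.cons (l b z) z')).1 = compatSummand μ ν ρ ψ d d' (fun i => (z i).1)
      (fun i => (z' i).1) (fun i => (z i).2) (fun i => (z' i).2) := by
  rw [hl.fst (cons_mem_sumGrading hP hl hz hz'), comp_cons Prod.fst, comp_cons Prod.snd,
    ← eq_compatSummand μ ν ρ ψ d d' _ _ _ _ _ _ (hl.fst hz) (hl.snd hz)]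
  simp only [← comp_cons Prod.fst]

theorem IsBicrossed.comp_snd (hP : IsMatchedPair 𝒢 μ ℋ ν ρ ψ) (hl : IsBicrossed 𝒢 μ ℋ ν ρ ψ l)
    {a b : ℕ} {d : Fin (b + 1) → ℤ} {d' : Fin a → ℤ} {z : Fin (b + 1) → V × W}
    {z' : Fin a → V × W} (hz : ∀ i, z i ∈ sumGrading 𝒢 ℋ (d i))
    (hz' : ∀ i, z' i ∈ sumGrading 𝒢 ℋ (d' i)) :
    (l a (Fin.cons (l b z) z')).2 = compatSummand ν μ ψ ρ d d' (fun i => (z i).2)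
      (fun i => (z' i).2) (fun i => (z i).1) (fun i => (z' i).1) := by
  rw [hl.snd (cons_mem_sumGrading hP hl hz hz'), comp_cons Prod.fst, comp_cons Prod.snd,
    ← eq_compatSummand ν μ ψ ρ d d' _ _ _ _ _ _ (hl.snd hz) (hl.fst hz)]
  simp only [← comp_cons Prod.snd]

/-- The bicrossed product of a matched pair is an `L_∞`-algebra. -/
theorem IsBicrossed.isLInfinityAlgebra (hP : IsMatchedPair 𝒢 μ ℋ ν ρ ψ)
    (hl : IsBicrossed 𝒢 μ ℋ ν ρ ψ l) : IsLInfinityAlgebra (sumGrading 𝒢 ℋ) l where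
  isInternal := isInternal_sumGrading hP.left.isInternal hP.right.isInternal
  degree _ _ _ hz := hl.mem hP hz
  skew n := hl.skew hP n
  jacobi n d z hz := by
    ext
    · rw [Prod.fst_sum, Prod.fst_zero, ← hP.compat_left n d (fun i => (z i).1) (fun i => (z i).2)
        (fun i => (hz i).1) (fun i => (hz i).2)]
      -- The sums agree shuffle by shuffle, with the same prefactor.
      refine sum_congr rfl fun p _ => ?_
      rw [jacobiTerm, compatTerm, Prod.fst_sum]
      refine sum_congr rfl fun σ _ => ?_
      rw [Prod.smul_fst, hl.comp_fst hP (fun i => hz _) (fun i => hz _)]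
    · rw [Prod.snd_sum, Prod.snd_zero, ← hP.compat_right n d (fun i => (z i).1)
        (fun i => (z i).2) (fun i => (hz i).1) (fun i => (hz i).2)]
      refine sum_congr rfl fun p _ => ?_
      rw [jacobiTerm, compatTerm, Prod.snd_sum]
      refine sum_congr rfl fun σ _ => ?_
      rw [Prod.smul_snd, hl.comp_snd hP (fun i => hz _) (fun i => hz _)]

end Bicrossed

/-! ### Lie algebras in degree `0`. -/

section Lie

variable {K : Type*} [Field K]

theorem mem_degreeZero {V : Type*} [AddCommGroup V] [Module K V] {i : ℤ} {x : V} :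
    x ∈ degreeZero K V i ↔ i = 0 ∨ x = 0 := by
  unfold degreeZero
  split_ifs with h <;> simp [h]

theorem isInternal_degreeZero (V : Type*) [AddCommGroup V] [Module K V] :
    DirectSum.IsInternal (degreeZero K V) := by
  rw [DirectSum.isInternal_submodule_iff_iSupIndep_and_iSup_eq_top]
  constructor
  · intro i
    by_cases h : i = 0
    · have : ⨆ j, ⨆ (_ : j ≠ i), degreeZero K V j = ⊥ := by
        refine le_bot_iff.1 (iSup₂_le fun j hj => ?_)
        simp [degreeZero, h ▸ hj]
      rw [this]
      exact disjoint_bot_right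
    · simp [degreeZero, h]
  · exact top_le_iff.1 (le_iSup_of_le 0 (by simp [degreeZero]))

theorem koszul_eq_one {N : ℕ} {d : Fin N → ℤ} (hd : ∀ i, d i = 0) (σ : Equiv.Perm (Fin N)) :
    koszul d σ = 1 := by
  simp [koszul, hd]

/-- In 0-based numbering the three shuffles split the letters as `01|2`, `02|1` and `12|0`. -/
theorem sum_shuffles_two_one {A : Type*} [AddCommMonoid A] (F : Equiv.Perm (Fin (2 + 1)) → A) :
    ∑ σ ∈ shuffles 2 1, F σ = F 1 + F (Equiv.swap 1 2) + F (finRotate 3) := by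
  have : shuffles 2 1 = {1, Equiv.swap 1 2, finRotate 3} := by decide
  rw [this, sum_insert (by decide), sum_insert (by decide), sum_singleton, add_assoc]

variable {g h : Type*} [LieRing g] [LieAlgebra K g] [LieRing h] [LieAlgebra K h]

theorem lieBrackets_of_ne {n : ℕ} (hn : n ≠ 1) : lieBrackets K g n = 0 := by
  match n, hn with
  | 0, _ => rfl
  | n + 2, _ => rfl

theorem lieActions_of_ne (ρ : g →ₗ[K] Module.End K h) {n : ℕ} (hn : n ≠ 1) :
    lieActions ρ n = 0 := by
  match n, hn with
  | 0, _ => rfl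
  | n + 2, _ => rfl

/-- The dichotomy behind the checks below: either every sign is the ungraded one, or some letter has
nonzero degree and hence vanishes. -/
theorem eq_zero_or_exists {N : ℕ} {d : Fin N → ℤ} {x : Fin N → g}
    (hx : ∀ i, x i ∈ degreeZero K g (d i)) : (∀ i, d i = 0) ∨ ∃ i, x i = 0 := by
  by_contra! hc
  obtain ⟨⟨i, hi⟩, hc⟩ := hc
  exact (mem_degreeZero.1 (hx i)).elim hi (hc i)

theorem perm_fin_two (σ : Equiv.Perm (Fin 2)) : σ = 1 ∨ σ = Equiv.swap 0 1 := by
  revert σ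
  decide

theorem isGradedSkew_lieBrackets (n : ℕ) :
    IsGradedSkew (degreeZero K g) (lieBrackets K g n) := by
  intro d x hx σ
  rcases eq_zero_or_exists hx with hd | ⟨i, hi⟩
  · rw [koszul_eq_one hd]
    by_cases hn : n = 1
    · subst hn
      rw [lieBrackets_one, lieBrackets_one]
      rcases perm_fin_two σ with rfl | rfl
      · simp
      · simp
    · simp [lieBrackets_of_ne hn]
  · rw [MultilinearMap.map_coord_zero _ i hi, MultilinearMap.map_coord_zero _ (σ.symm i) (by simpa),
      smul_zero]

theorem isGradedSkew_lieActions (ρ : g →ₗ[K] Module.End K h) (n : ℕ) :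
    IsGradedSkew (degreeZero K g) (lieActions ρ n) := by
  intro d x hx σ
  rcases eq_zero_or_exists hx with hd | ⟨i, hi⟩
  · rw [koszul_eq_one hd]
    by_cases hn : n = 1
    · subst hn
      rw [Subsingleton.elim σ 1]
      simp
    · simp [lieActions_of_ne ρ hn]
  · rw [MultilinearMap.map_coord_zero _ i hi, MultilinearMap.map_coord_zero _ (σ.symm i) (by simpa),
      smul_zero]

theorem jacobiTerm_lieBrackets (a b : ℕ) {d : Fin (b + 1 + a) → ℤ} {x : Fin (b + 1 + a) → g}
    (hx : ∀ i, x i ∈ degreeZero K g (d i)) : jacobiTerm (lieBrackets K g) a b d x = 0 := by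
  by_cases ha : a = 1
  swap
  · simp [jacobiTerm, lieBrackets_of_ne ha]
  by_cases hb : b = 1
  swap
  · subst ha
    simp [jacobiTerm, lieBrackets_of_ne hb, lieBrackets_one]
  subst ha hb
  have h1 : Equiv.Perm.sign (finRotate 3) = 1 := by decide
  have h2 : Equiv.Perm.sign (Equiv.swap (1 : Fin 3) 2) = -1 := by decide
  have h3 : Equiv.swap (1 : Fin 3) 2 0 = 0 := by decide
  have h4 : Int.negOnePow 2 = 1 := rfl
  rw [jacobiTerm, sum_shuffles_two_one]
  rcases eq_zero_or_exists hx with hd | ⟨i, hi⟩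
  · simp [koszul_eq_one hd, lieBrackets_one, h1, h2, h3, h4]
    -- Jacobi eliminates one of the three nested brackets; the inner brackets are then sorted by
    -- index.
    have hJ : ⁅x 2, ⁅x 0, x 1⁆⁆ = ⁅x 1, ⁅x 0, x 2⁆⁆ - ⁅x 0, ⁅x 1, x 2⁆⁆ := by
      rw [← lie_skew, lie_lie]
      abel
    rw [← lie_skew (x 2) (x 1), ← lie_skew (x 2) (x 0), ← lie_skew (x 1) (x 0)]
    simp only [lie_neg, hJ]
    abel
  · fin_cases i <;> simp at hi <;> simp [lieBrackets_one, hi, h3]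

theorem isLInfinityAlgebra_lieBrackets :
    IsLInfinityAlgebra (degreeZero K g) (lieBrackets K g) where
  isInternal := isInternal_degreeZero g
  degree n d x hx := by
    rw [mem_degreeZero]
    by_cases hn : n = 1
    · subst hn
      rcases eq_zero_or_exists hx with hd | ⟨i, hi⟩
      · simp [hd]
      · exact Or.inr (MultilinearMap.map_coord_zero _ i hi)
    · simp [lieBrackets_of_ne hn]
  skew := isGradedSkew_lieBrackets
  jacobi n d x hx := sum_eq_zero fun p _ => jacobiTerm_lieBrackets _ _ fun i => hx _

/-- Only `a = b = 1` survives, where the three shuffles give the three terms of `hρ`. The hypothesis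
`hu` picks out the last index by its value, since `Fin (b + 1 + a)` is not in successor form. -/
theorem repTerm_lie {ρ : g →ₗ[K] Module.End K h}
    (hρ : ∀ (x y : g) (u : h), ρ ⁅x, y⁆ u = ρ x (ρ y u) - ρ y (ρ x u)) (a b : ℕ)
    {d : Fin (b + 1 + a) → ℤ} {x : Fin (b + 1 + a) → g} {u : h}
    (hx : ∀ i, x i ∈ degreeZero K g (d i)) (hu : ∀ i : Fin (b + 1 + a), (i : ℕ) = b + a → u ∈ degreeZero K h (d i)) :
    repTermInner (lieActions ρ) a b d x u + repTermOuter (lieBrackets K g) (lieActions ρ) a b d x u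
      = 0 := by
  by_cases ha : a = 1
  swap
  · cases a <;> simp [repTermInner, repTermOuter, lieActions_of_ne ρ ha]
  by_cases hb : b = 1
  swap
  · subst ha
    simp [repTermInner, repTermOuter, lieBrackets_of_ne hb, lieActions_of_ne ρ hb, lieActions_one]
  subst ha hb
  have h1 : Equiv.Perm.sign (finRotate 3) = 1 := by decide
  have h2 : Equiv.Perm.sign (Equiv.swap (1 : Fin 3) 2) = -1 := by decide
  have h3 : Equiv.swap (1 : Fin 3) 2 0 = 0 := by decide
  have h4 : Int.negOnePow 2 = 1 := rfl
  -- Two shuffles feed the module element to the inner action; the identity leaves it to the outer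
  -- one.
  have hf : ({σ ∈ shuffles 2 1 | (σ 1 : ℕ) = 2} : Finset (Equiv.Perm (Fin (2 + 1)))) =
    {Equiv.swap 1 2, finRotate 3} := by decide
  have hf' : ({σ ∈ shuffles 2 1 | σ 2 = 2} : Finset (Equiv.Perm (Fin (2 + 1)))) = {1} := by decide
  have hne : Equiv.swap (1 : Fin 3) 2 ≠ finRotate 3 := by decide
  have e1 : repTermInner (lieActions ρ) 1 1 d x u = _ := sum_congr hf fun _ _ => rfl
  have e2 : repTermOuter (lieBrackets K g) (lieActions ρ) 1 1 d x u = _ :=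
    sum_congr hf' fun _ _ => rfl
  rw [e1, e2, sum_pair hne, sum_singleton]
  by_cases hd : ∀ i, d i = 0
  · simp [koszul_eq_one hd, lieBrackets_one, lieActions_one, h1, h2, h3, h4, hd, hρ]
    abel
  · push Not at hd
    obtain ⟨i, hi⟩ := hd
    have hi' := (mem_degreeZero.1 (hx i)).resolve_left hi
    -- At the last place `x` does not occur, and it is `u` that vanishes.
    have hi'' := fun hu' => (mem_degreeZero.1 (hu i hu')).resolve_left hi
    fin_cases i <;> simp at hi' hi'' <;> simp [lieBrackets_one, lieActions_one, hi', hi'', h3]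

/-- For `a = b = 1` this is the `g`-component of the Jacobi identity of the bicrossed Lie bracket: a
combination of Jacobi in `g`, the representation property of `ψ` and `compat_right`. -/
theorem compatTerm_lie {ρ : g →ₗ[K] Module.End K h} {ψ : h →ₗ[K] Module.End K g}
    (hP : IsLieMatchedPair ρ ψ) (a b : ℕ)
    {d : Fin (b + 1 + a) → ℤ} {x : Fin (b + 1 + a) → g} {u : Fin (b + 1 + a) → h}
    (hx : ∀ i, x i ∈ degreeZero K g (d i)) (hu : ∀ i, u i ∈ degreeZero K h (d i)) :
    compatTerm (lieBrackets K g) (lieBrackets K h) (lieActions ρ) (lieActions ψ) a b d x u = 0 := by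
  by_cases ha : a = 1
  swap
  · simp [compatTerm, compatSummand, lieBrackets_of_ne ha, lieActions_of_ne _ ha]
  by_cases hb : b = 1
  swap
  · subst ha
    simp [compatTerm, compatSummand, lieBrackets_of_ne hb, lieActions_of_ne _ hb, lieActions_one,
      lieBrackets_one, Fin.removeNth_apply]
  subst ha hb
  have h1 : Equiv.Perm.sign (finRotate 3) = 1 := by decide
  have h2 : Equiv.Perm.sign (Equiv.swap (1 : Fin 3) 2) = -1 := by decide
  have h3 : Equiv.swap (1 : Fin 3) 2 0 = 0 := by decide
  have h4 : Int.negOnePow 2 = 1 := rfl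
  rw [compatTerm, sum_shuffles_two_one]
  by_cases hd : ∀ i, d i = 0
  · simp [koszul_eq_one hd, lieBrackets_one, lieActions_one, h1, h2, h3, h4, hd,
      compatSummand, moveSign, Fin.removeNth_apply]
    -- A normal form for mixed brackets, so that equal terms cancel in `abel`.
    have hs : ∀ (y : g) (v : h) (z : g), ⁅y, ψ v z⁆ = -⁅ψ v z, y⁆ := fun y v z =>
      (lie_skew _ _).symm
    have hJ : ⁅x 2, ⁅x 0, x 1⁆⁆ = ⁅x 1, ⁅x 0, x 2⁆⁆ - ⁅x 0, ⁅x 1, x 2⁆⁆ := by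
      rw [← lie_skew, lie_lie]
      abel
    rw [← lie_skew (x 2) (x 1), ← lie_skew (x 2) (x 0), ← lie_skew (x 1) (x 0)]
    simp only [lie_neg, hJ, hP.rep_right, hP.compat_right, hs]
    abel
  · push Not at hd
    obtain ⟨i, hi⟩ := hd
    have hi' := (mem_degreeZero.1 (hx i)).resolve_left hi
    have hi'' := (mem_degreeZero.1 (hu i)).resolve_left hi
    fin_cases i <;> simp at hi' hi'' <;> simp [lieBrackets_one, lieActions_one, hi', hi'', h3,
      compatSummand, Fin.removeNth_apply]

theorem isRepresentation_lieActions {ρ : g →ₗ[K] Module.End K h}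
    (hρ : ∀ (x y : g) (u : h), ρ ⁅x, y⁆ u = ρ x (ρ y u) - ρ y (ρ x u)) :
    IsRepresentation (degreeZero K g) (lieBrackets K g) (degreeZero K h) (lieActions ρ) where
  isInternal := isInternal_degreeZero h
  degree n d e x u hx hu := by
    rw [mem_degreeZero]
    by_cases hn : n = 1
    · subst hn
      rcases mem_degreeZero.1 hu with he | rfl
      · rcases eq_zero_or_exists hx with hd | ⟨i, hi⟩
        · simp [hd, he]
        · simp [MultilinearMap.map_coord_zero _ i hi]
      · simp
    · simp [lieActions_of_ne ρ hn]
  skew := isGradedSkew_lieActions ρ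
  identity n d x u hx hu := by
    rw [← sum_add_distrib]
    refine sum_eq_zero fun p _ => repTerm_lie hρ _ _ (fun i => hx _) fun i hi => ?_
    have : Fin.cast (arity p) i = Fin.last n := by
      have := arity p
      ext
      simp only [Fin.val_cast, Fin.val_last]
      omega
    rwa [this]

theorem IsLieMatchedPair.symm {ρ : g →ₗ[K] Module.End K h} {ψ : h →ₗ[K] Module.End K g}
    (hP : IsLieMatchedPair ρ ψ) : IsLieMatchedPair ψ ρ :=
  ⟨hP.rep_right, hP.rep_left, hP.compat_right, hP.compat_left⟩

/-- A matched pair of Lie algebras is a matched pair of `L_∞`-algebras. -/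
theorem IsLieMatchedPair.isMatchedPair {ρ : g →ₗ[K] Module.End K h} {ψ : h →ₗ[K] Module.End K g}
    (hP : IsLieMatchedPair ρ ψ) :
    IsMatchedPair (degreeZero K g) (lieBrackets K g) (degreeZero K h) (lieBrackets K h)
      (lieActions ρ) (lieActions ψ) where
  left := isLInfinityAlgebra_lieBrackets
  right := isLInfinityAlgebra_lieBrackets
  rep_left := isRepresentation_lieActions hP.rep_left
  rep_right := isRepresentation_lieActions hP.rep_right
  compat_left _ _ _ _ hx hu :=
    sum_eq_zero fun _ _ => compatTerm_lie hP _ _ (fun _ => hx _) fun _ => hu _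
  compat_right _ _ _ _ hx hu :=
    sum_eq_zero fun _ _ => compatTerm_lie hP.symm _ _ (fun _ => hu _) fun _ => hx _

theorem mem_sumGrading_degreeZero (z : g × h) :
    z ∈ sumGrading (degreeZero K g) (degreeZero K h) 0 :=
  ⟨mem_degreeZero.2 (Or.inl rfl), mem_degreeZero.2 (Or.inl rfl)⟩

variable {ρ : g →ₗ[K] Module.End K h} {ψ : h →ₗ[K] Module.End K g} {l : Brackets K (g × h)}

theorem IsBicrossed.lie_apply (hl : IsBicrossed (degreeZero K g) (lieBrackets K g)
      (degreeZero K h) (lieBrackets K h) (lieActions ρ) (lieActions ψ) l) (x y : g) (u v : h) :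
    l 1 ![(x, u), (y, v)] = (⁅x, y⁆ + ψ u y - ψ v x, ⁅u, v⁆ + ρ x v - ρ y u) := by
  -- Every element is homogeneous of degree `0`, so the defining formula applies to all arguments.
  rw [hl 1 (fun _ => 0) _ fun i => mem_sumGrading_degreeZero _]
  ext <;> simp [ltimes, rtimes, lieBrackets_one, lieActions_one, moveSign, Fin.removeNth_apply] <;>
    abel

theorem IsBicrossed.lie_of_ne (hl : IsBicrossed (degreeZero K g) (lieBrackets K g)
      (degreeZero K h) (lieBrackets K h) (lieActions ρ) (lieActions ψ) l) {n : ℕ} (hn : n ≠ 1) :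
    l n = 0 := by
  ext z : 1
  rw [hl n (fun _ => 0) _ fun i => mem_sumGrading_degreeZero _]
  simp [ltimes, rtimes, lieBrackets_of_ne hn, lieActions_of_ne _ hn]

end Lie

end LInf

theorem mainTheorem9 {K : Type*} [Field K] [CharZero K] :
    (∀ {V W : Type*} [AddCommGroup V] [Module K V] [AddCommGroup W] [Module K W]
      (𝒢 : ℤ → Submodule K V) (μ : LInf.Brackets K V)
      (ℋ : ℤ → Submodule K W) (ν : LInf.Brackets K W)
      (ρ : LInf.Actions K V W) (ψ : LInf.Actions K W V),
      LInf.IsMatchedPair 𝒢 μ ℋ ν ρ ψ →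
      ∃ l : LInf.Brackets K (V × W),
        LInf.IsBicrossed 𝒢 μ ℋ ν ρ ψ l ∧
        LInf.IsLInfinityAlgebra (LInf.sumGrading 𝒢 ℋ) l ∧
        ∀ l' : LInf.Brackets K (V × W), LInf.IsBicrossed 𝒢 μ ℋ ν ρ ψ l' → l' = l) ∧
    (∀ {g h : Type*} [LieRing g] [LieAlgebra K g] [LieRing h] [LieAlgebra K h]
      (ρ : g →ₗ[K] Module.End K h) (ψ : h →ₗ[K] Module.End K g),
      LInf.IsLieMatchedPair ρ ψ →
      LInf.IsMatchedPair (LInf.degreeZero K g) (LInf.lieBrackets K g)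
        (LInf.degreeZero K h) (LInf.lieBrackets K h) (LInf.lieActions ρ) (LInf.lieActions ψ) ∧
      ∀ l : LInf.Brackets K (g × h),
        LInf.IsBicrossed (LInf.degreeZero K g) (LInf.lieBrackets K g)
          (LInf.degreeZero K h) (LInf.lieBrackets K h) (LInf.lieActions ρ) (LInf.lieActions ψ) l →
        (∀ (x y : g) (u v : h),
          l 1 ![(x, u), (y, v)] = (⁅x, y⁆ + ψ u y - ψ v x, ⁅u, v⁆ + ρ x v - ρ y u)) ∧
        ∀ n : ℕ, n ≠ 1 → l n = 0) := by
  refine ⟨fun 𝒢 μ ℋ ν ρ ψ hP => ?_, fun ρ ψ hP => ⟨hP.isMatchedPair, fun l hl =>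
    ⟨hl.lie_apply, fun _ => hl.lie_of_ne⟩⟩⟩
  obtain ⟨l, hl⟩ :=
    LInf.exists_isBicrossed μ ν ρ ψ hP.left.isInternal hP.right.isInternal
  exact ⟨l, hl, hl.isLInfinityAlgebra hP,
    fun _ hl' => LInf.isBicrossed_unique hP.left.isInternal hP.right.isInternal hl hl'⟩
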